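/- Let $N\ge 2$ and $j\ge 0$ be integers with $N\ge 2j+1$, let $0\le p\le 1$, and let $$\rho=p\,|GHZ_N\rangle\langle GHZ_N|+\frac{1-p}{2^N}I_{2^N},\qquad |GHZ_N\rangle=\tfrac1{\sqrt2}\left(|0\rangle^{\otimes N}+|1\rangle^{\otimes N}\right)$$ be the $N$-qubit noisy GHZ state. For a partition $\pi$ of the set of $N$ qubits into nonempty parties, a state is called separable for $\pi$ if it is a finite convex combination $\sum_i p_i\bigotimes_{B\in\pi}\rho_B^{(i)}$, where each $\rho_B^{(i)}$ is a density matrix of the qubits in $B$. A state is called $K$-separable if it is a finite convex combination of states each of which is separable for some partition of the qubits into exactly $K$ parties; the partition may differ from term to term. A state is called separable for the partition type $1^{|(N-2j)}|2^{|j}$ if it is a finite convex combination of states each of which is separable for some partition into $N-2j$ parties of one qubit each and $j$ parties of two qubits each; again the partition, that is, the choice of which qubits form which parties, may differ from term to term. Then the following hold. 1. $\rho$ is $(N-j)$-separable if and only if $$p\le\frac{1}{1+\frac{N-2j}{N}2^{N-1}}.$$ 2. The same bound is the exact threshold for the partition type $1^{|(N-2j)}|2^{|j}$ alone (a type with $N-j$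 parties, so that the bound in 1 is already attained by this type): $\rho$ is separable for the partition type $1^{|(N-2j)}|2^{|j}$ if and only if $$p\le\frac{1}{1+\frac{N-2j}{N}2^{N-1}}.$$ -/

import Mathlib

open scoped ComplexOrder

/-- Computational basis labels for the qubits indexed by `ι`: binary strings over `ι`. -/
abbrev QubitString (ι : Type) : Type := ι → Fin 2

/-- Density matrices: positive semidefinite complex matrices of trace one. -/
def IsDensityMatrix {m : Type} [Fintype m] (ρ : Matrix m m ℂ) : Prop :=
  ρ.PosSemidef ∧ ρ.trace = 1

/-- The vector `|GHZ_N⟩ = (|0⟩^{⊗N} + |1⟩^{⊗N}) / √2` in the computational basis. -/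
noncomputable def ghzVector (N : ℕ) : QubitString (Fin N) → ℂ :=
  ((1 / Real.sqrt 2 : ℝ) : ℂ) •
    ((Pi.single (fun _ => 0) 1 : QubitString (Fin N) → ℂ) + Pi.single (fun _ => 1) 1)

/-- The noisy GHZ state `p |GHZ_N⟩⟨GHZ_N| + ((1 - p) / 2^N) I`. -/
noncomputable def noisyGHZ (N : ℕ) (p : ℝ) :
    Matrix (QubitString (Fin N)) (QubitString (Fin N)) ℂ :=
  (p : ℂ) • Matrix.vecMulVec (ghzVector N) (star (ghzVector N)) +
    (((1 - p) / 2 ^ N : ℝ) : ℂ) • (1 : Matrix (QubitString (Fin N)) (QubitString (Fin N)) ℂ)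

/-- A division of the `N` qubits into nonempty, pairwise disjoint parties. -/
abbrev QubitPartition (N : ℕ) : Type := Finpartition (Finset.univ : Finset (Fin N))

/-- The multiset of the numbers of qubits in the parties. -/
def QubitPartition.sizes {N : ℕ} (π : QubitPartition N) : Multiset ℕ :=
  π.parts.val.map Finset.card

/-- The tensor product, over the parties `B` of `π`, of the matrices `σ B` on the qubits in `B`:
its `(x, y)` entry is the product of the entries of `σ B` at the restrictions of `x`, `y` to `B`. -/
def tensorOver {N : ℕ} (π : QubitPartition N)
    (σ : (B : Finset (Fin N)) → Matrix (QubitString B) (QubitString B) ℂ) :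
    Matrix (QubitString (Fin N)) (QubitString (Fin N)) ℂ :=
  Matrix.of fun x y => ∏ B ∈ π.parts, σ B (fun i => x i) (fun i => y i)

/-- Product states with respect to `π`: one density matrix for every party. -/
def IsProductState {N : ℕ} (π : QubitPartition N)
    (ρ : Matrix (QubitString (Fin N)) (QubitString (Fin N)) ℂ) : Prop :=
  ∃ σ : (B : Finset (Fin N)) → Matrix (QubitString B) (QubitString B) ℂ,
    (∀ B ∈ π.parts, IsDensityMatrix (σ B)) ∧ ρ = tensorOver π σ

/-- Separability with respect to one fixed set partition `π`: probability mixtures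
`∑ᵢ pᵢ ⨂_B ρ_B⁽ⁱ⁾` of product states for `π`. -/
def IsSeparableFor {N : ℕ} (π : QubitPartition N)
    (ρ : Matrix (QubitString (Fin N)) (QubitString (Fin N)) ℂ) : Prop :=
  ρ ∈ convexHull ℝ {τ | IsProductState π τ}

/-- `K`-separability: probability mixtures of states each of which is separable for some
partition into exactly `K` parties, where the partition may vary from term to term. -/
def IsKSeparable {N : ℕ} (K : ℕ)
    (ρ : Matrix (QubitString (Fin N)) (QubitString (Fin N)) ℂ) : Prop :=
  ρ ∈ convexHull ℝ {τ | ∃ π : QubitPartition N, π.parts.card = K ∧ IsSeparableFor π τ}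

/-- Separability for a partition type `s` (a multiset of party sizes, so that which qubits belong
to which party is irrelevant): probability mixtures of states each of which is separable for some
partition whose parties have the sizes `s`; the partitions occurring differ from one another by
permutations of the qubits. -/
def IsSeparableForType {N : ℕ} (s : Multiset ℕ)
    (ρ : Matrix (QubitString (Fin N)) (QubitString (Fin N)) ℂ) : Prop :=
  ρ ∈ convexHull ℝ {τ | ∃ π : QubitPartition N, π.sizes = s ∧ IsSeparableFor π τ}

/-- The partition type `1^{|(N-2j)}|2^{|j}`: `N - 2j` single qubits and `j` pairs of qubits. -/
def singlesAndPairs (N j : ℕ) : Multiset ℕ :=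
  Multiset.replicate (N - 2 * j) 1 + Multiset.replicate j 2

/-!
The noisy GHZ state has corner coherence `c = ⟨0…0|ρ|1…1⟩ = p / 2`, and every string other than
`0…0` and `1…1` has population (diagonal entry) `(1 - p) / 2 ^ N`. The bound on `p` says
`(N - 2 * j) * (p / 2) ≤ N * ((1 - p) / 2 ^ N)` (`le_threshold_iff`). Separability for the type
`1^{N-2j} 2^j` implies `(N - j)`-separability, so it suffices to show that the latter implies the
bound and that the bound implies the former.

*Necessity.* If a set `A` of qubits is a union of parties, positivity of the `2 × 2` minors of the
factors of a product state bounds `|c|²` by the product of the populations of the two strings that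
are constant on `A` and on its complement (`norm_sq_tensorOver_corner_le`). A partition into `N - j`
parties has at least `N - 2 * j` one-qubit parties (`QubitPartition.two_mul_card_le`); for each of
them the arithmetic-geometric mean inequality bounds `|c|` by the mean of two populations.
Summing yields a linear inequality, which survives convex combinations
(`IsKSeparable.mul_corner_le`).

*Sufficiency.* On each party `B` of a partition take the vector `|0…0⟩ + (∏ i ∈ B, u i) |1…1⟩`, with
cube roots of unity `u i` of total product one. Averaging the resulting product states over `u`
leaves, up to normalization, the two corner coherences and equal populations on the strings that are
constant on every party (`phaseAverage_eq_sum`). Averaging further over all relabellings of a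
partition of type `1^{N-2j} 2^j`, a string of weight `0 < w < N` gets as its population the
proportion of the `w`-element sets that split none of `j` disjoint pairs, which is at most
`(N - 2 * j) / N` (`mul_coeff_le_mul_choose`, `QubitPartition.mul_card_perm_isUnion_le`). Under the
bound the noisy GHZ state is therefore `p / 2` times this average plus a nonnegative diagonal
matrix, and the basis states are product states for every partition.
-/

open scoped Polynomial NNReal
open Polynomial

/-! ### A binomial inequality -/

theorem choose_le_choose_two_mul (j m : ℕ) : j.choose m ≤ (2 * j).choose (2 * m) := by
  induction j generalizing m with
  | zero => cases m <;> simp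
  | succ j ih =>
    cases m with
    | zero => simp
    | succ m =>
      have h1 := ih m
      have h2 := ih (m + 1)
      have h3 : (2 * (j + 1)).choose (2 * (m + 1)) = (2 * j).choose (2 * m) +
          (2 * j).choose (2 * m + 1) + ((2 * j).choose (2 * m + 1) +
          (2 * j).choose (2 * (m + 1))) := by
        simp only [Nat.mul_add, Nat.mul_one, Nat.choose_succ_succ' (2 * j + 1) (2 * m + 1),
          Nat.choose_succ_succ' (2 * j)]
      rw [h3, Nat.choose_succ_succ']
      omega

/-- Among `2 * j` elements arranged in `j` pairs, the sets made of `m` full pairs and one half of a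
further pair are counted by the left-hand side. -/
theorem two_mul_mul_choose_le (j m : ℕ) :
    2 * (m + 1) * j.choose (m + 1) ≤ (2 * j).choose (2 * m + 1) := by
  induction j generalizing m with
  | zero => simp
  | succ j ih =>
    have h2 := ih m
    have h0 := choose_le_choose_two_mul j m
    cases m with
    | zero => simp
    | succ m =>
      have h1 := ih m
      have h3 : (2 * (j + 1)).choose (2 * (m + 1) + 1) = (2 * j).choose (2 * m + 1) +
          (2 * j).choose (2 * (m + 1)) + ((2 * j).choose (2 * (m + 1)) +
          (2 * j).choose (2 * (m + 1) + 1)) := by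
        simp only [Nat.mul_add, Nat.mul_one, Nat.choose_succ_succ' (2 * j + 1) (2 * m + 2),
          Nat.choose_succ_succ' (2 * j)]
      rw [h3, Nat.choose_succ_succ']
      nlinarith

theorem mul_choose_le_choose_even (j m : ℕ) :
    (2 * j + 1) * j.choose (m + 1) ≤ (2 * j + 1).choose (2 * (m + 1)) := by
  have h1 := two_mul_mul_choose_le j m
  have h2 : (2 * j + 1) * (2 * j).choose (2 * m + 1) =
      (2 * j + 1).choose (2 * (m + 1)) * (2 * (m + 1)) := Nat.add_one_mul_choose_eq _ _
  have h3 : (2 * (m + 1)) * ((2 * j + 1) * j.choose (m + 1)) ≤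
      (2 * (m + 1)) * (2 * j + 1).choose (2 * (m + 1)) := by
    nlinarith [Nat.mul_le_mul_left (2 * j + 1) h1]
  exact Nat.le_of_mul_le_mul_left h3 (by omega)

theorem coeff_one_add_X_sq_pow_mul (j w : ℕ) :
    (((1 + X ^ 2) ^ j * (1 + X) : ℕ[X])).coeff w = j.choose (w / 2) := by
  have h : ((1 + X ^ 2) ^ j : ℕ[X]) = expand ℕ 2 ((1 + X) ^ j) := by simp
  rw [mul_add, mul_one, coeff_add, h]
  cases w with
  | zero => rw [← h]; simp [coeff_zero_eq_eval_zero]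
  | succ w =>
    rw [coeff_mul_X, coeff_expand (by norm_num), coeff_expand (by norm_num), coeff_one_add_X_pow,
      coeff_one_add_X_pow]
    rcases Nat.even_or_odd' w with ⟨k, rfl | rfl⟩
    · rw [if_neg (by omega), if_pos (by omega)]
      simp; congr 1; omega
    · rw [if_pos (by omega), if_neg (by omega)]
      simp

/-- For `N = 2 * j + (s + 1)` and `0 < w < N`: among the `w`-element subsets of an `N`-element set,
the proportion of those which split none of `j` disjoint pairs is at most `(s + 1) / N`, the
proportion attained at `w = 1`. The number of such subsets is written as a coefficient of its
generating function. -/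
theorem mul_coeff_le_mul_choose (j s w : ℕ) (hw : 0 < w) (hwN : w < 2 * j + (s + 1)) :
    (2 * j + (s + 1)) * (((1 + X ^ 2) ^ j * (1 + X) ^ (s + 1) : ℕ[X])).coeff w ≤
      (s + 1) * (2 * j + (s + 1)).choose w := by
  induction s generalizing w with
  | zero =>
    rw [zero_add, pow_one, coeff_one_add_X_sq_pow_mul, one_mul]
    rcases Nat.even_or_odd' w with ⟨k, rfl | rfl⟩
    · obtain ⟨m, rfl⟩ : ∃ m, k = m + 1 := ⟨k - 1, by omega⟩
      simpa using mul_choose_le_choose_even j m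
    · -- odd sizes reduce to even ones by passing to the complement
      obtain ⟨m, rfl⟩ : ∃ m, j = k + (m + 1) := ⟨j - k - 1, by omega⟩
      have h := mul_choose_le_choose_even (k + (m + 1)) m
      rw [show (2 * k + 1) / 2 = k by omega]
      rwa [← Nat.choose_symm_add, Nat.choose_symm_of_eq_add
        (show 2 * (k + (m + 1)) + 1 = (2 * (m + 1)) + (2 * k + 1) by ring)] at h
  | succ s ih =>
    have hP : ((1 + X ^ 2) ^ j * (1 + X) ^ (s + 1 + 1) : ℕ[X]) =
      (1 + X ^ 2) ^ j * (1 + X) ^ (s + 1) + (1 + X ^ 2) ^ j * (1 + X) ^ (s + 1) * X := by ring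
    obtain ⟨v, rfl⟩ : ∃ v, w = v + 1 := ⟨w - 1, by omega⟩
    set P : ℕ[X] := (1 + X ^ 2) ^ j * (1 + X) ^ (s + 1) with hPdef
    have hP0 : P.coeff 0 = 1 := by
      rw [coeff_zero_eq_eval_zero]; simp [hPdef]
    have hPN : P.coeff (2 * j + (s + 1)) = 1 := by
      have m1 : (1 + X ^ 2 : ℕ[X]).Monic := by monicity!
      have m2 : (1 + X : ℕ[X]).Monic := by monicity!
      have d1 : (1 + X ^ 2 : ℕ[X]).natDegree = 2 := by compute_degree!
      have d2 : (1 + X : ℕ[X]).natDegree = 1 := by compute_degree!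
      have hm := (m1.pow j).mul (m2.pow (s + 1))
      have hd : P.natDegree = 2 * j + (s + 1) := by
        rw [hPdef, (m1.pow j).natDegree_mul (m2.pow (s + 1)), m1.natDegree_pow, m2.natDegree_pow,
          d1, d2]
        ring
      rw [← hd]
      exact hm.coeff_natDegree
    rw [hP, coeff_add, coeff_mul_X, show 2 * j + (s + 1 + 1) = 2 * j + (s + 1) + 1 by ring,
      Nat.choose_succ_succ']
    rcases Nat.eq_zero_or_pos j with rfl | hj
    · rw [hPdef, pow_zero, one_mul, coeff_one_add_X_pow, coeff_one_add_X_pow]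
      simp only [Nat.cast_id, mul_zero, zero_add]
      rw [add_comm ((s + 1).choose (v + 1))]
    set N := 2 * j + (s + 1) with hN
    rcases Nat.eq_zero_or_pos v with rfl | hv
    · have h := ih 1 one_pos (by omega)
      rw [Nat.choose_one_right, mul_comm] at h
      have h' := Nat.le_of_mul_le_mul_right h (by omega)
      simp only [zero_add, hP0, Nat.choose_zero_right, Nat.choose_one_right]
      nlinarith
    · have hcv := ih v hv (by omega)
      rcases Nat.lt_or_ge (v + 1) N with hlt | hge
      · have hcv1 := ih (v + 1) (by omega) hlt
        -- `s / N` increases when `s` and `N` grow by one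
        have hsN : (s + 1) * (N + 1) ≤ (s + 1 + 1) * N := by nlinarith
        have hsum : N * (P.coeff (v + 1) + P.coeff v) ≤
            (s + 1) * (N.choose v + N.choose (v + 1)) := by nlinarith
        refine le_of_mul_le_mul_left ?_ (show 0 < N by omega)
        nlinarith [Nat.mul_le_mul_left (N + 1) hsum,
          Nat.mul_le_mul_right (N.choose v + N.choose (v + 1)) hsN]
      · have hvN : N = v + 1 := by omega
        rw [← hvN, hPN, Nat.choose_self]
        have hc : N.choose v = N := by rw [hvN, Nat.choose_succ_self_right]
        rw [hc, mul_comm] at hcv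
        have h' := Nat.le_of_mul_le_mul_right hcv (by omega)
        rw [hc]
        nlinarith

/-! ### Partitions with prescribed party sizes -/

/-- Any multiset of positive integers with sum `s.card` is the multiset of part sizes of a partition
of `s`. -/
theorem exists_finpartition_sizes {α : Type*} [DecidableEq α] (m : Multiset ℕ)
    (hm : ∀ a ∈ m, 0 < a) (s : Finset α) (hs : m.sum = s.card) :
    ∃ P : Finpartition s, P.parts.val.map Finset.card = m := by
  induction m using Multiset.induction_on generalizing s with
  | empty =>
    have hs' : s = ∅ := by simpa using hs.symm
    subst hs'
    exact ⟨Finpartition.empty _, by simp⟩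
  | cons a m ih =>
    rw [Multiset.sum_cons] at hs
    obtain ⟨t, hts, hta⟩ := Finset.exists_subset_card_eq (show a ≤ s.card by omega)
    obtain ⟨P, hP⟩ := ih (fun b hb => hm b (Multiset.mem_cons_of_mem hb)) (s \ t)
      (by rw [Finset.card_sdiff_of_subset hts]; omega)
    have ht : t ≠ ⊥ := by
      rintro rfl
      have := hm a (Multiset.mem_cons_self a m)
      simp at hta
      omega
    refine ⟨P.extend ht Finset.sdiff_disjoint (Finset.sdiff_union_of_subset hts), ?_⟩
    have htP : t ∉ P.parts := fun h => by
      have h1 := P.le h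
      exact ht (Finset.sdiff_disjoint.eq_bot_of_ge h1)
    rw [Finpartition.extend_parts, Finset.insert_val_of_notMem htP, Multiset.map_cons, hP, hta]

theorem exists_qubitPartition_singlesAndPairs {N j : ℕ} (hj : 2 * j ≤ N) :
    ∃ π : QubitPartition N, π.sizes = singlesAndPairs N j := by
  refine exists_finpartition_sizes (singlesAndPairs N j) ?_ _ ?_
  · intro a ha
    rcases Multiset.mem_add.1 ha with h | h <;> rw [Multiset.eq_of_mem_replicate h] <;> norm_num
  · simp [singlesAndPairs]
    omega

namespace QubitPartition

variable {N : ℕ}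

/-- The set `A` is a union of parties of `π`; that is, no party is split between `A` and its
complement. -/
def IsUnion (π : QubitPartition N) (A : Finset (Fin N)) : Prop :=
  ∀ B ∈ π.parts, B ⊆ A ∨ Disjoint B A

instance (π : QubitPartition N) (A : Finset (Fin N)) : Decidable (π.IsUnion A) :=
  inferInstanceAs (Decidable (∀ B ∈ π.parts, B ⊆ A ∨ Disjoint B A))

theorem card_parts_eq (π : QubitPartition N) : π.parts.card = π.sizes.card := by
  simp [sizes]

/-- The partition `π` transported along a permutation of the qubits. -/
def perm (g : Equiv.Perm (Fin N)) (π : QubitPartition N) : QubitPartition N :=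
  (π.map (Equiv.toOrderIso g.finsetCongr (fun _ _ h => Finset.map_subset_map.2 h)
    (fun _ _ h => Finset.map_subset_map.2 h))).copy (Finset.map_univ_equiv g)

theorem parts_perm (g : Equiv.Perm (Fin N)) (π : QubitPartition N) :
    (π.perm g).parts = π.parts.map g.finsetCongr.toEmbedding := rfl

theorem sizes_perm (g : Equiv.Perm (Fin N)) (π : QubitPartition N) :
    (π.perm g).sizes = π.sizes := by
  simp [sizes, parts_perm, Finset.map_val, Multiset.map_map, Function.comp_def]

theorem isUnion_perm {g : Equiv.Perm (Fin N)} {π : QubitPartition N} {A : Finset (Fin N)} :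
    (π.perm g).IsUnion A ↔ π.IsUnion (A.map g⁻¹.toEmbedding) := by
  have hA : A = (A.map g⁻¹.toEmbedding).map g.toEmbedding := by
    ext i; simp [Equiv.Perm.inv_def]
  simp only [IsUnion, parts_perm, Finset.forall_mem_map]
  refine forall₂_congr fun B _ => ?_
  conv_lhs => rw [hA]
  simp only [Equiv.coe_toEmbedding, Equiv.finsetCongr_apply, Finset.map_subset_map,
    Finset.disjoint_map]

theorem IsUnion.biUnion_filter {π : QubitPartition N} {A : Finset (Fin N)} (h : π.IsUnion A) :
    (π.parts.filter (· ⊆ A)).biUnion id = A := by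
  ext i
  simp only [Finset.mem_biUnion, Finset.mem_filter, id]
  constructor
  · rintro ⟨B, ⟨_, hB⟩, hi⟩
    exact hB hi
  · intro hi
    obtain ⟨B, hB, hiB⟩ := π.exists_mem (Finset.mem_univ i)
    refine ⟨B, ⟨hB, (h B hB).resolve_right fun hd => ?_⟩, hiB⟩
    exact Finset.disjoint_left.1 hd hiB hi

/-- The product `∏ B, (1 + X ^ |B|)` is the generating polynomial of the sets of parties, counted by
their total number of qubits. -/
theorem coeff_prod_one_add_X_pow (π : QubitPartition N) (w : ℕ) :
    ((π.sizes.map fun a => (1 + X ^ a : ℕ[X])).prod).coeff w =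
      (π.parts.powerset.filter fun P => ∑ B ∈ P, B.card = w).card := by
  have h : (π.sizes.map fun a => (1 + X ^ a : ℕ[X])).prod =
      ∏ B ∈ π.parts, (1 + X ^ B.card : ℕ[X]) := by
    rw [sizes, Multiset.map_map]
    rfl
  rw [h, Finset.prod_one_add, finsetSum_coeff, Finset.card_filter]
  refine Finset.sum_congr rfl fun P _ => ?_
  rw [Finset.prod_pow_eq_pow_sum, coeff_X_pow]
  simp only [eq_comm]

theorem card_isUnion_le_coeff (π : QubitPartition N) (w : ℕ) :
    ((Finset.univ.powersetCard w).filter fun A => π.IsUnion A).card ≤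
      ((π.sizes.map fun a => (1 + X ^ a : ℕ[X])).prod).coeff w := by
  rw [coeff_prod_one_add_X_pow]
  refine Finset.card_le_card_of_injOn (fun A => π.parts.filter (· ⊆ A)) ?_ ?_
  · intro A hA
    simp only [Finset.coe_filter, Finset.mem_powersetCard, Set.mem_ofPred_eq] at hA
    obtain ⟨⟨_, hw⟩, hu⟩ := hA
    simp only [Finset.coe_filter, Finset.mem_powerset, Set.mem_ofPred_eq]
    refine ⟨Finset.filter_subset _ _, ?_⟩
    rw [← hw]
    conv_rhs => rw [← hu.biUnion_filter]
    rw [Finset.card_biUnion]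
    · rfl
    · intro B hB C hC hBC
      exact π.disjoint (Finset.mem_filter.1 hB).1 (Finset.mem_filter.1 hC).1 hBC
  · intro A hA A' hA' h
    simp only [Finset.coe_filter, Set.mem_ofPred_eq] at hA hA'
    rw [← hA.2.biUnion_filter, ← hA'.2.biUnion_filter]
    exact congrArg (fun P => P.biUnion id) h

end QubitPartition

theorem exists_perm_map_eq {α : Type*} [Fintype α] [DecidableEq α] {A A' : Finset α}
    (h : A.card = A'.card) : ∃ g : Equiv.Perm α, A.map g.toEmbedding = A' := by
  let e : {x // x ∈ A} ≃ {x // x ∈ A'} := Fintype.equivOfCardEq (by simpa using h)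
  refine ⟨e.extendSubtype, ?_⟩
  refine Finset.eq_of_subset_of_card_le ?_ (by simp [h])
  intro y hy
  obtain ⟨x, hx, rfl⟩ := Finset.mem_map.1 hy
  exact e.extendSubtype_mem x hx

/-- Under a random permutation a set `A` is uniformly distributed among the sets of its
cardinality. -/
theorem card_perm_filter_mul_choose {α : Type*} [Fintype α] [DecidableEq α]
    (T : Finset α → Prop) [DecidablePred T] (A : Finset α) :
    (Finset.univ.filter fun g : Equiv.Perm α => T (A.map g.toEmbedding)).card *
        (Fintype.card α).choose A.card =
      (Fintype.card α).factorial * ((Finset.univ.powersetCard A.card).filter T).card := by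
  let F : Finset α → ℕ := fun A' =>
    (Finset.univ.filter fun g : Equiv.Perm α => T (A'.map g.toEmbedding)).card
  have hF : ∀ A' ∈ Finset.univ.powersetCard A.card, F A' = F A := by
    intro A' hA'
    obtain ⟨h, rfl⟩ := exists_perm_map_eq (Finset.mem_powersetCard.1 hA').2.symm
    refine Finset.card_bij' (fun g _ => g * h) (fun g _ => g * h⁻¹) ?_ ?_ ?_ ?_
    · intro g hg
      simpa [Finset.map_map, Equiv.Perm.mul_def] using hg
    · intro g hg
      have : (A.map h.toEmbedding).map (g * h⁻¹).toEmbedding = A.map g.toEmbedding := by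
        rw [Finset.map_map]
        congr 1
        ext
        simp
      simpa [this] using hg
    · intro g _; simp
    · intro g _; simp
  have h1 : ∑ A' ∈ Finset.univ.powersetCard A.card, F A' =
      (Fintype.card α).choose A.card * F A := by
    rw [Finset.sum_congr rfl hF, Finset.sum_const, Finset.card_powersetCard, smul_eq_mul,
      Finset.card_univ]
  have h2 : ∑ A' ∈ Finset.univ.powersetCard A.card, F A' =
      ∑ _g : Equiv.Perm α, ((Finset.univ.powersetCard A.card).filter T).card := by
    simp only [F, Finset.card_filter]
    rw [Finset.sum_comm]
    refine Finset.sum_congr rfl fun g _ => ?_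
    refine Finset.sum_bij' (fun A' _ => A'.map g.toEmbedding)
      (fun A' _ => A'.map g⁻¹.toEmbedding) ?_ ?_ ?_ ?_ ?_
    · intro A' hA'; simpa using hA'
    · intro A' hA'; simpa using hA'
    · intro A' _; ext; simp [Equiv.Perm.inv_def]
    · intro A' _; ext; simp [Equiv.Perm.inv_def]
    · intro A' _; rfl
  rw [mul_comm, ← h1, h2, Finset.sum_const, Finset.card_univ, Fintype.card_perm, smul_eq_mul]

/-- Among the relabellings of a partition of type `1^{N-2j} 2^j`, the proportion of those having a
given nontrivial set of qubits as a union of parties is at most `(N - 2j) / N`. -/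
theorem QubitPartition.mul_card_perm_isUnion_le {N j : ℕ} (hj : 2 * j + 1 ≤ N)
    {π : QubitPartition N} (hπ : π.sizes = singlesAndPairs N j) {A : Finset (Fin N)}
    (hA : 0 < A.card) (hAN : A.card < N) :
    N * (Finset.univ.filter fun g : Equiv.Perm (Fin N) => (π.perm g).IsUnion A).card ≤
      (N - 2 * j) * N.factorial := by
  have hinv : (Finset.univ.filter fun g : Equiv.Perm (Fin N) => (π.perm g).IsUnion A).card =
      (Finset.univ.filter fun g : Equiv.Perm (Fin N) => π.IsUnion (A.map g.toEmbedding)).card := by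
    refine Finset.card_bij' (fun g _ => g⁻¹) (fun g _ => g⁻¹) ?_ ?_ ?_ ?_ <;>
      simp [isUnion_perm]
  have h1 := card_perm_filter_mul_choose (fun A => π.IsUnion A) A
  have h2 := π.card_isUnion_le_coeff A.card
  obtain ⟨s, rfl⟩ : ∃ s, N = 2 * j + (s + 1) := ⟨N - 2 * j - 1, by omega⟩
  have h3 := mul_coeff_le_mul_choose j s A.card hA hAN
  have h4 : (π.sizes.map fun a => (1 + X ^ a : ℕ[X])).prod =
      (1 + X ^ 2) ^ j * (1 + X) ^ (s + 1) := by
    rw [hπ, singlesAndPairs]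
    simp only [Multiset.map_add, Multiset.map_replicate, Multiset.prod_add,
      Multiset.prod_replicate, pow_one, show 2 * j + (s + 1) - 2 * j = s + 1 by omega]
    ring
  rw [h4] at h2
  rw [Fintype.card_fin] at h1
  rw [hinv, show 2 * j + (s + 1) - 2 * j = s + 1 by omega]
  have hpos := Nat.choose_pos hAN.le
  refine le_of_mul_le_mul_right ?_ hpos
  rw [mul_assoc, h1]
  calc (2 * j + (s + 1)) * ((2 * j + (s + 1)).factorial * _)
      = (2 * j + (s + 1)).factorial * ((2 * j + (s + 1)) * _) := by ring
    _ ≤ (2 * j + (s + 1)).factorial * ((s + 1) * (2 * j + (s + 1)).choose A.card) :=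
        Nat.mul_le_mul_left _ ((Nat.mul_le_mul_left _ h2).trans h3)
    _ = _ := by ring

/-! ### Necessity of the bound -/

theorem norm_sq_apply_le_of_posSemidef {m : Type*} {A : Matrix m m ℂ}
    (hA : A.PosSemidef) (x y : m) : ‖A x y‖ ^ 2 ≤ (A x x).re * (A y y).re := by
  have h := (hA.submatrix ![x, y]).det_nonneg
  rw [Matrix.det_fin_two] at h
  have hyx : A y x = star (A x y) := (hA.isHermitian.apply y x).symm
  have hx := Complex.le_def.1 (hA.diag_nonneg (i := x))
  have hy := Complex.le_def.1 (hA.diag_nonneg (i := y))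
  have h' := (Complex.le_def.1 h).1
  simp [hyx, ← hx.2, ← hy.2] at h'
  rw [Complex.sq_norm, Complex.normSq_apply]
  linarith

/-- The computational basis label with ones exactly on `A`. -/
def bitString {N : ℕ} (A : Finset (Fin N)) : QubitString (Fin N) := fun i => if i ∈ A then 1 else 0

theorem re_tensorOver_apply_self {N : ℕ} {π : QubitPartition N}
    {σ : (B : Finset (Fin N)) → Matrix (QubitString B) (QubitString B) ℂ}
    (hσ : ∀ B ∈ π.parts, IsDensityMatrix (σ B)) (x : QubitString (Fin N)) :
    (tensorOver π σ x x).re = ∏ B ∈ π.parts, (σ B (fun i => x i) (fun i => x i)).re := by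
  rw [← Complex.ofReal_re (∏ B ∈ π.parts, (σ B (fun i => x i) (fun i => x i)).re),
    tensorOver, Matrix.of_apply, Complex.ofReal_prod]
  congr 1
  refine Finset.prod_congr rfl fun B hB => ?_
  have h := Complex.le_def.1 ((hσ B hB).1.diag_nonneg (i := fun i => x i))
  exact Complex.ext (by simp) (by simpa using h.2.symm)

theorem re_tensorOver_apply_self_nonneg {N : ℕ} {π : QubitPartition N}
    {σ : (B : Finset (Fin N)) → Matrix (QubitString B) (QubitString B) ℂ}
    (hσ : ∀ B ∈ π.parts, IsDensityMatrix (σ B)) (x : QubitString (Fin N)) :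
    0 ≤ (tensorOver π σ x x).re := by
  rw [re_tensorOver_apply_self hσ]
  exact Finset.prod_nonneg fun B hB =>
    (Complex.le_def.1 ((hσ B hB).1.diag_nonneg (i := fun i => x i))).1

/-- For product states and a union `A` of parties, the corner coherence is dominated by the
populations of the two complementary strings that are constant on `A` and on its complement. -/
theorem norm_sq_tensorOver_corner_le {N : ℕ} {π : QubitPartition N}
    {σ : (B : Finset (Fin N)) → Matrix (QubitString B) (QubitString B) ℂ}
    (hσ : ∀ B ∈ π.parts, IsDensityMatrix (σ B)) {A : Finset (Fin N)} (hA : π.IsUnion A) :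
    ‖tensorOver π σ (bitString ∅) (bitString Finset.univ)‖ ^ 2 ≤
      (tensorOver π σ (bitString A) (bitString A)).re *
        (tensorOver π σ (bitString Aᶜ) (bitString Aᶜ)).re := by
  rw [re_tensorOver_apply_self hσ, re_tensorOver_apply_self hσ]
  rw [tensorOver, Matrix.of_apply, norm_prod, ← Finset.prod_pow, ← Finset.prod_mul_distrib]
  refine Finset.prod_le_prod (fun _ _ => by positivity) fun B hB => ?_
  have h0 : (fun i : B => bitString (∅ : Finset (Fin N)) i) = fun _ => 0 := by
    funext i; simp [bitString]
  have h1 : (fun i : B => bitString (Finset.univ : Finset (Fin N)) i) = fun _ => 1 := by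
    funext i; simp [bitString]
  have h := norm_sq_apply_le_of_posSemidef (hσ B hB).1 (fun _ => 0) (fun _ => 1)
  rw [h0, h1]
  rcases hA B hB with hBA | hBA
  · have h2 : (fun i : B => bitString A i) = fun _ => 1 := by
      funext i; simp [bitString, hBA i.2]
    have h3 : (fun i : B => bitString Aᶜ i) = fun _ => 0 := by
      funext i; simp [bitString, hBA i.2]
    rw [h2, h3, mul_comm]
    exact h
  · have h2 : (fun i : B => bitString A i) = fun _ => 0 := by
      funext i; simp [bitString, Finset.disjoint_left.1 hBA i.2]
    have h3 : (fun i : B => bitString Aᶜ i) = fun _ => 1 := by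
      funext i; simp [bitString, Finset.disjoint_left.1 hBA i.2]
    rw [h2, h3]
    exact h

theorem QubitPartition.isUnion_of_mem {N : ℕ} {π : QubitPartition N} {A : Finset (Fin N)}
    (hA : A ∈ π.parts) : π.IsUnion A := fun B hB => by
  by_cases h : B = A
  · exact Or.inl h.subset
  · exact Or.inr (π.disjoint hB hA h)

/-- A partition of `N` qubits into `K` parties has at least `2 * K - N` one-qubit parties. -/
theorem QubitPartition.two_mul_card_le {N : ℕ} (π : QubitPartition N) :
    2 * π.parts.card ≤ N + (Finset.univ.filter fun i => {i} ∈ π.parts).card := by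
  have h1 : ∑ B ∈ π.parts, 2 ≤ ∑ B ∈ π.parts, (B.card + if B.card = 1 then 1 else 0) := by
    refine Finset.sum_le_sum fun B hB => ?_
    have := (π.nonempty_of_mem_parts hB).card_pos
    split_ifs <;> omega
  rw [Finset.sum_add_distrib, π.sum_card_parts, ← Finset.card_filter, Finset.card_univ,
    Fintype.card_fin, Finset.sum_const, smul_eq_mul] at h1
  have h2 : (π.parts.filter fun B => B.card = 1).card ≤
      (Finset.univ.filter fun i => {i} ∈ π.parts).card := by
    refine Finset.card_le_card_of_surjOn (fun i => {i}) ?_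
    intro B hB
    obtain ⟨hB, hB1⟩ := Finset.mem_filter.1 (Finset.mem_coe.1 hB)
    obtain ⟨i, rfl⟩ := Finset.card_eq_one.1 hB1
    exact ⟨i, by simpa using hB, rfl⟩
  omega

/-- The populations of the strings with one deviating qubit, halved and summed over the qubit. -/
noncomputable def singleFlipPopulation {N : ℕ}
    (ρ : Matrix (QubitString (Fin N)) (QubitString (Fin N)) ℂ) : ℝ :=
  ∑ i, ((ρ (bitString {i}) (bitString {i})).re + (ρ (bitString {i}ᶜ) (bitString {i}ᶜ)).re) / 2

/-- The corner coherence of an `(N - j)`-separable state is bounded by its single-flip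
populations, since every admissible partition has at least `N - 2 * j` one-qubit parties. -/
theorem IsKSeparable.mul_corner_le {N j : ℕ} (hj : 2 * j + 1 ≤ N)
    {ρ : Matrix (QubitString (Fin N)) (QubitString (Fin N)) ℂ} (hρ : IsKSeparable (N - j) ρ) :
    ((N : ℝ) - 2 * j) * (ρ (bitString ∅) (bitString Finset.univ)).re ≤
      singleFlipPopulation ρ := by
  have hconv : Convex ℝ {τ : Matrix (QubitString (Fin N)) (QubitString (Fin N)) ℂ |
      ((N : ℝ) - 2 * j) * (τ (bitString ∅) (bitString Finset.univ)).re -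
        singleFlipPopulation τ ≤ 0} := by
    refine convex_halfSpace_le ⟨fun x y => ?_, fun c x => ?_⟩ 0
    · simp only [singleFlipPopulation, Matrix.add_apply, Complex.add_re, add_div,
        Finset.sum_add_distrib]
      ring
    · simp only [singleFlipPopulation, Matrix.smul_apply, Complex.smul_re, smul_eq_mul,
        mul_sub, Finset.mul_sum]
      congr 1
      · ring
      · exact Finset.sum_congr rfl fun i _ => by ring
  rw [← sub_nonpos]
  refine convexHull_min ?_ hconv hρ
  rintro τ ⟨π, hπ, hτ⟩
  refine convexHull_min ?_ hconv hτ
  rintro τ ⟨σ, hσ, rfl⟩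
  rw [Set.mem_ofPred_eq, sub_nonpos]
  set c := (tensorOver π σ (bitString ∅) (bitString Finset.univ))
  have hcard : ((N : ℝ) - 2 * j) ≤ (Finset.univ.filter fun i => {i} ∈ π.parts).card := by
    have h := π.two_mul_card_le
    rw [hπ] at h
    have h' : N ≤ 2 * j + (Finset.univ.filter fun i => {i} ∈ π.parts).card := by omega
    have h'' : (N : ℝ) ≤ 2 * j + (Finset.univ.filter fun i => {i} ∈ π.parts).card := by
      exact_mod_cast h'
    linarith
  have hN : (0 : ℝ) ≤ (N : ℝ) - 2 * j := by
    have : ((2 * j + 1 : ℕ) : ℝ) ≤ N := by exact_mod_cast hj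
    push_cast at this
    linarith
  have hpop : ∀ i, 0 ≤ ((tensorOver π σ (bitString {i}) (bitString {i})).re +
      (tensorOver π σ (bitString {i}ᶜ) (bitString {i}ᶜ)).re) / 2 := by
    intro i
    have h1 := re_tensorOver_apply_self_nonneg hσ (bitString {i})
    have h2 := re_tensorOver_apply_self_nonneg hσ (bitString {i}ᶜ)
    positivity
  calc ((N : ℝ) - 2 * j) * c.re ≤ ((N : ℝ) - 2 * j) * ‖c‖ :=
        mul_le_mul_of_nonneg_left (Complex.re_le_norm c) hN
    _ ≤ (Finset.univ.filter fun i => {i} ∈ π.parts).card * ‖c‖ :=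
        mul_le_mul_of_nonneg_right hcard (norm_nonneg c)
    _ = ∑ i with {i} ∈ π.parts, ‖c‖ := by rw [Finset.sum_const, nsmul_eq_mul]
    _ ≤ ∑ i with {i} ∈ π.parts, ((tensorOver π σ (bitString {i}) (bitString {i})).re +
          (tensorOver π σ (bitString {i}ᶜ) (bitString {i}ᶜ)).re) / 2 := by
        refine Finset.sum_le_sum fun i hi => ?_
        have h := norm_sq_tensorOver_corner_le hσ
          (QubitPartition.isUnion_of_mem (Finset.mem_filter.1 hi).2)
        set a := (tensorOver π σ (bitString {i}) (bitString {i})).re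
        set b := (tensorOver π σ (bitString {i}ᶜ) (bitString {i}ᶜ)).re
        rw [← pow_le_pow_iff_left₀ (norm_nonneg c) (hpop i) two_ne_zero]
        nlinarith [sq_nonneg (a - b)]
    _ ≤ singleFlipPopulation (tensorOver π σ) :=
        Finset.sum_le_univ_sum_of_nonneg hpop

/-! ### Averaging over phases -/

/-- Assignments of cube roots of unity to the qubits with total phase one. -/
def phaseGroup (N : ℕ) : Subgroup (Fin N → rootsOfUnity 3 ℂ) where
  carrier := {u | ∏ i, u i = 1}
  one_mem' := by simp
  mul_mem' := fun {u v} hu hv => by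
    have hu' : ∏ i, u i = 1 := hu
    have hv' : ∏ i, v i = 1 := hv
    simp [Finset.prod_mul_distrib, hu', hv']
  inv_mem' := fun {u} hu => by
    have hu' : ∏ i, u i = 1 := hu
    simp [Finset.prod_inv_distrib, hu']

noncomputable instance (N : ℕ) : Fintype (phaseGroup N) := Fintype.ofFinite _

/-- The character `u ↦ ∏ i, u i ^ e i` of the phase group. -/
noncomputable def phaseChar {N : ℕ} (e : Fin N → ℤ) : phaseGroup N →* ℂ where
  toFun u := (((∏ i, (u.1 i) ^ e i : rootsOfUnity 3 ℂ) : ℂˣ) : ℂ)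
  map_one' := by simp
  map_mul' u v := by simp [mul_zpow, Finset.prod_mul_distrib]

theorem phaseChar_of_const {N : ℕ} {e : Fin N → ℤ} (h : ∀ k l, e k = e l) (u : phaseGroup N) :
    phaseChar e u = 1 := by
  have hu : ∏ i, u.1 i = 1 := u.2
  rcases isEmpty_or_nonempty (Fin N) with h0 | ⟨⟨k⟩⟩
  · simp [phaseChar]
  · have : ∏ i, (u.1 i) ^ e i = 1 := by
      rw [Finset.prod_congr rfl fun i _ => by rw [h i k], Finset.prod_zpow, hu, one_zpow]
    change (((∏ i, (u.1 i) ^ e i : rootsOfUnity 3 ℂ) : ℂˣ) : ℂ) = 1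
    rw [this]
    rfl

theorem sum_phaseChar_eq_zero {N : ℕ} {e : Fin N → ℤ} {k l : Fin N} (h : ¬ (3 : ℤ) ∣ e k - e l) :
    ∑ u, phaseChar e u = 0 := by
  refine sum_hom_units_eq_zero _ fun h1 => ?_
  have hkl : k ≠ l := by rintro rfl; simp at h
  have hζ := Complex.isPrimitiveRoot_exp 3 (by norm_num)
  obtain ⟨ζ, hζ⟩ : ∃ ζ : rootsOfUnity 3 ℂ, IsPrimitiveRoot ζ 3 :=
    ⟨hζ.toRootsOfUnity,
      IsPrimitiveRoot.coe_submonoidClass_iff.1 (IsPrimitiveRoot.coe_units_iff.1 hζ)⟩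
  let u : phaseGroup N := ⟨Pi.mulSingle k ζ * Pi.mulSingle l ζ⁻¹, by
    change ∏ i, _ = 1
    simp [Finset.prod_mul_distrib]⟩
  have hu : ∏ i, (u.1 i) ^ e i = ζ ^ (e k - e l) := by
    have : ∀ i, (u.1 i) ^ e i = Pi.mulSingle (M := fun _ => rootsOfUnity 3 ℂ) k (ζ ^ e k) i *
        Pi.mulSingle (M := fun _ => rootsOfUnity 3 ℂ) l ((ζ ^ e l)⁻¹) i := by
      intro i
      simp only [u, Pi.mul_apply, mul_zpow]
      by_cases hik : i = k
      · subst hik; simp [hkl]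
      · by_cases hil : i = l
        · subst hil; simp [hik]
        · simp [hik, hil]
    rw [Finset.prod_congr rfl fun i _ => this i, Finset.prod_mul_distrib]
    simp [zpow_sub]
  have h2 : phaseChar e u = 1 := by rw [h1]; rfl
  have h3 : ζ ^ (e k - e l) = 1 := by
    rw [← hu]
    apply Subtype.ext
    apply Units.ext
    exact h2
  exact h ((hζ.zpow_eq_one_iff_dvd _).1 h3)

/-- The set of qubits with label one. -/
def onesSet {N : ℕ} (x : QubitString (Fin N)) : Finset (Fin N) := Finset.univ.filter (x · = 1)

/-- The difference of two binary strings as an integer vector. -/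
def stringDiff {N : ℕ} (x y : QubitString (Fin N)) (i : Fin N) : ℤ := (x i : ℤ) - (y i : ℤ)

/-- The unnormalized superposition `|0…0⟩ + (∏ i, u i) |1…1⟩` of the qubits in `B`. -/
noncomputable def blockVector {N : ℕ} (u : phaseGroup N) (B : Finset (Fin N)) :
    QubitString B → ℂ :=
  fun z => if ∃ c, ∀ i, z i = c then ∏ i : B, ((u.1 i : ℂˣ) : ℂ) ^ (z i : ℕ) else 0

theorem conj_rootOfUnity_coe (ζ : rootsOfUnity 3 ℂ) :
    star (((ζ : ℂˣ) : ℂ)) = (((ζ : ℂˣ) : ℂ))⁻¹ := by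
  rw [← Units.val_inv_eq_inv_val]
  exact Complex.conj_rootsOfUnity ζ.2

theorem isDensityMatrix_blockVector {N : ℕ} (u : phaseGroup N) {B : Finset (Fin N)}
    (hB : B.Nonempty) : IsDensityMatrix
      ((1 / 2 : ℝ) • Matrix.vecMulVec (blockVector u B) (star (blockVector u B))) := by
  classical
  refine ⟨(Matrix.posSemidef_vecMulVec_self_star _).smul (by norm_num), ?_⟩
  have h : ∀ z, blockVector u B z * star (blockVector u B z) =
      if z ∈ Finset.univ.image (fun c : Fin 2 => fun _ : B => c) then 1 else 0 := by
    intro z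
    have hz : z ∈ Finset.univ.image (fun c : Fin 2 => fun _ : B => c) ↔ ∃ c, ∀ i, z i = c := by
      simp [funext_iff, eq_comm]
    simp only [hz, blockVector]
    split_ifs
    · rw [star_prod, ← Finset.prod_mul_distrib]
      refine Finset.prod_eq_one fun i _ => ?_
      rw [star_pow, conj_rootOfUnity_coe, ← mul_pow, mul_inv_cancel₀ (Units.ne_zero _), one_pow]
    · simp
  obtain ⟨i, hi⟩ := hB
  rw [Matrix.trace_smul, Matrix.trace_vecMulVec, dotProduct]
  simp only [Pi.star_apply]
  rw [Finset.sum_congr rfl fun z _ => h z, Finset.sum_ite_mem, Finset.univ_inter, Finset.sum_const,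
    Finset.card_image_of_injective _ fun a b hab => congrFun hab ⟨i, hi⟩]
  simp

theorem QubitPartition.isUnion_onesSet_iff {N : ℕ} {π : QubitPartition N}
    {x : QubitString (Fin N)} :
    π.IsUnion (onesSet x) ↔ ∀ B ∈ π.parts, ∃ c, ∀ i : B, x i = c := by
  refine forall₂_congr fun B _ => ?_
  constructor
  · rintro (h | h)
    · exact ⟨1, fun i => (Finset.mem_filter.1 (h i.2)).2⟩
    · refine ⟨0, fun i => ?_⟩
      have := Finset.disjoint_left.1 h i.2
      simp [onesSet] at this
      omega
  · rintro ⟨c, hc⟩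
    by_cases h1 : c = 1
    · left
      intro i hi
      simp [onesSet, hc ⟨i, hi⟩, h1]
    · right
      refine Finset.disjoint_left.2 fun i hi => ?_
      simp [onesSet, hc ⟨i, hi⟩, h1]

theorem prod_blockVector {N : ℕ} (π : QubitPartition N) (u : phaseGroup N)
    (x : QubitString (Fin N)) :
    ∏ B ∈ π.parts, blockVector u B (fun i => x i) =
      if π.IsUnion (onesSet x) then ∏ i, ((u.1 i : ℂˣ) : ℂ) ^ (x i : ℕ) else 0 := by
  simp only [blockVector, QubitPartition.isUnion_onesSet_iff]
  rw [Finset.prod_ite_zero]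
  congr 1
  have h : ∏ i, ((u.1 i : ℂˣ) : ℂ) ^ (x i : ℕ) =
      ∏ i ∈ π.parts.biUnion id, ((u.1 i : ℂˣ) : ℂ) ^ (x i : ℕ) := by rw [π.biUnion_parts]
  rw [h, Finset.prod_biUnion π.disjoint]
  refine Finset.prod_congr rfl fun B _ => ?_
  exact Finset.prod_coe_sort B (fun i => ((u.1 i : ℂˣ) : ℂ) ^ (x i : ℕ))

theorem tensorOver_blockVector_apply {N : ℕ} (π : QubitPartition N) (u : phaseGroup N)
    (x y : QubitString (Fin N)) :
    tensorOver π (fun B => (1 / 2 : ℝ) • Matrix.vecMulVec (blockVector u B)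
      (star (blockVector u B))) x y =
      (1 / 2) ^ π.parts.card * if π.IsUnion (onesSet x) ∧ π.IsUnion (onesSet y) then
        phaseChar (stringDiff x y) u else 0 := by
  have h : ∀ B, ((1 / 2 : ℝ) • Matrix.vecMulVec (blockVector u B)
      (star (blockVector u B))) (fun i => x i) (fun i => y i) =
      (1 / 2) * (blockVector u B (fun i => x i) * star (blockVector u B (fun i => y i))) := by
    intro B
    simp [Matrix.vecMulVec_apply]
  rw [tensorOver, Matrix.of_apply, Finset.prod_congr rfl fun B _ => h B, Finset.prod_mul_distrib,
    Finset.prod_mul_distrib, ← star_prod, prod_blockVector, prod_blockVector, Finset.prod_const]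
  congr 1
  by_cases hx : π.IsUnion (onesSet x) <;> by_cases hy : π.IsUnion (onesSet y) <;> simp [hx, hy]
  have hd : ∀ i, (u.1 i) ^ stringDiff x y i = (u.1 i) ^ (x i : ℕ) * ((u.1 i) ^ (y i : ℕ))⁻¹ := by
    intro i
    rw [stringDiff, zpow_sub]; simp
  simp only [phaseChar, MonoidHom.coe_mk, OneHom.coe_mk, hd, Finset.prod_mul_distrib]
  have hconj : ∀ i, (starRingEnd ℂ) (((u.1 i : ℂˣ) : ℂ)) = (((u.1 i : ℂˣ) : ℂ))⁻¹ :=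
    fun i => conj_rootOfUnity_coe (u.1 i)
  simp [hconj]

/-- The phase average of the product states built from `|0…0⟩ + |1…1⟩` on every party, up to
normalization: besides the corner coherences it has equal populations on all strings that are
constant on the parties. -/
noncomputable def phaseAverage {N : ℕ} (π : QubitPartition N) :
    Matrix (QubitString (Fin N)) (QubitString (Fin N)) ℂ :=
  Matrix.of fun x y => if (π.IsUnion (onesSet x) ∧ π.IsUnion (onesSet y)) ∧
    ∀ k l, stringDiff x y k = stringDiff x y l then 1 else 0

theorem phaseAverage_eq_sum {N : ℕ} (π : QubitPartition N) :
    phaseAverage π = ∑ u : phaseGroup N, (2 ^ π.parts.card / Fintype.card (phaseGroup N) : ℝ) •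
      tensorOver π (fun B => (1 / 2 : ℝ) • Matrix.vecMulVec (blockVector u B)
      (star (blockVector u B))) := by
  ext x y
  have hG : (Fintype.card (phaseGroup N) : ℂ) ≠ 0 := by exact_mod_cast Fintype.card_ne_zero
  simp only [Matrix.sum_apply, Matrix.smul_apply, tensorOver_blockVector_apply, phaseAverage,
    Matrix.of_apply]
  by_cases hxy : π.IsUnion (onesSet x) ∧ π.IsUnion (onesSet y)
  · simp only [hxy, true_and, and_self, if_true, ← Finset.smul_sum, ← Finset.mul_sum]
    split_ifs with hd
    · rw [Finset.sum_congr rfl fun u _ => phaseChar_of_const hd u]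
      simp
      field_simp
    · push Not at hd
      obtain ⟨k, l, hkl⟩ := hd
      rw [sum_phaseChar_eq_zero (k := k) (l := l)]
      · simp
      · -- the differences lie in `{-1, 0, 1}`, hence are determined modulo three
        simp only [stringDiff] at hkl ⊢
        omega
  · simp [hxy]

/-! ### Sufficiency of the bound -/

theorem real_smul_mem_span {M : Type*} [AddCommMonoid M] [Module ℝ M] {S : Set M} {a : M} {r : ℝ}
    (hr : 0 ≤ r) (ha : a ∈ Submodule.span ℝ≥0 S) : r • a ∈ Submodule.span ℝ≥0 S :=
  Submodule.smul_mem _ (⟨r, hr⟩ : ℝ≥0) ha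

/-- A trace-one element of the cone generated by trace-one matrices is a convex combination of
them. -/
theorem mem_convexHull_of_mem_span_of_trace {m : Type} [Fintype m] {S : Set (Matrix m m ℂ)}
    (hS : ∀ τ ∈ S, τ.trace = 1) {ρ : Matrix m m ℂ} (hρ : ρ ∈ Submodule.span ℝ≥0 S)
    (htr : ρ.trace = 1) : ρ ∈ convexHull ℝ S := by
  obtain ⟨n, f, g, rfl⟩ := Submodule.mem_span_set'.1 hρ
  have hsum : ∑ i, (f i : ℝ) = 1 := by
    rw [Matrix.trace_sum] at htr
    have h : ∀ i, (f i • (g i : Matrix m m ℂ)).trace = ((f i : ℝ) : ℂ) := by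
      intro i
      rw [Matrix.trace_smul, hS _ (g i).2, NNReal.smul_def, Complex.real_smul, mul_one]
    rw [Finset.sum_congr rfl fun i _ => h i] at htr
    exact_mod_cast htr
  exact (convex_convexHull ℝ S).sum_mem (fun i _ => (f i).2) hsum
    fun i _ => subset_convexHull ℝ S (g i).2

/-- The basis state `|x⟩⟨x|` is a product state for every partition. -/
theorem isProductState_single {N : ℕ} (π : QubitPartition N) (x : QubitString (Fin N)) :
    IsProductState π (Matrix.single x x 1) := by
  refine ⟨fun B => Matrix.single (fun i => x i) (fun i => x i) 1, fun B _ => ⟨?_, by simp⟩, ?_⟩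
  · change (Matrix.single (fun i : B => x i) (fun i : B => x i) (1 : ℂ)).PosSemidef
    rw [← Matrix.diagonal_single]
    refine Matrix.PosSemidef.diagonal fun z => ?_
    by_cases h : z = fun i : B => x i
    · subst h; simp
    · simp [Pi.single_eq_of_ne h]
  · ext y z
    simp only [tensorOver, Matrix.of_apply, Matrix.single_apply]
    rw [Finset.prod_ite_zero, Finset.prod_const_one]
    congr 1
    simp only [funext_iff, eq_iff_iff, Subtype.forall]
    constructor
    · rintro ⟨h1, h2⟩ B _
      exact ⟨fun i _ => h1 i, fun i _ => h2 i⟩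
    · intro h
      refine ⟨fun i => ?_, fun i => ?_⟩ <;>
        obtain ⟨B, hB, hi⟩ := π.exists_mem (Finset.mem_univ i)
      · exact (h B hB).1 i hi
      · exact (h B hB).2 i hi

theorem IsProductState.trace_eq_one {N : ℕ} {π : QubitPartition N}
    {τ : Matrix (QubitString (Fin N)) (QubitString (Fin N)) ℂ} (h : IsProductState π τ) :
    τ.trace = 1 := by
  obtain ⟨σ, hσ, rfl⟩ := h
  have hprod := Finset.prod_univ_sum (fun _ : π.parts => Finset.univ)
    (fun (B : π.parts) (z : QubitString B.1) => σ B.1 z z)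
  have h1 : ∏ B : π.parts, ∑ z : QubitString B.1, σ B.1 z z = 1 :=
    Finset.prod_eq_one fun B _ => (hσ B.1 B.2).2
  rw [h1, Fintype.piFinset_univ] at hprod
  rw [hprod, Matrix.trace]
  refine Fintype.sum_bijective (fun x (B : π.parts) (i : B.1) => x i) ⟨?_, ?_⟩ _ _ fun x => ?_
  · intro x y hxy
    funext i
    obtain ⟨B, hB, hi⟩ := π.exists_mem (Finset.mem_univ i)
    exact congrFun (congrFun hxy ⟨B, hB⟩) ⟨i, hi⟩
  · intro q
    refine ⟨fun i => q ⟨π.part i, π.part_mem.2 (Finset.mem_univ i)⟩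
      ⟨i, π.mem_part (Finset.mem_univ i)⟩, ?_⟩
    funext ⟨B, hB⟩ ⟨i, hi⟩
    have hBi : π.part i = B := π.part_eq_of_mem hB hi
    subst hBi
    rfl
  · exact (Finset.prod_coe_sort π.parts fun B => σ B (fun i => x i) (fun i => x i)).symm

theorem phaseAverage_mem_span {N : ℕ} (π : QubitPartition N) :
    phaseAverage π ∈ Submodule.span ℝ≥0 {τ | IsProductState π τ} := by
  rw [phaseAverage_eq_sum]
  refine Submodule.sum_mem _ fun u _ => real_smul_mem_span (by positivity)
    (Submodule.subset_span ⟨_, fun B hB => ?_, rfl⟩)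
  exact isDensityMatrix_blockVector u (π.nonempty_of_mem_parts hB)

theorem noisyGHZ_apply (N : ℕ) (p : ℝ) (x y : QubitString (Fin N)) :
    noisyGHZ N p x y = (p / 2 : ℝ) *
      (((if x = fun _ => 0 then 1 else 0) + (if x = fun _ => 1 then 1 else 0)) *
      ((if y = fun _ => 0 then 1 else 0) + (if y = fun _ => 1 then 1 else 0))) +
      ((1 - p) / 2 ^ N : ℝ) * (if x = y then 1 else 0) := by
  have h : ((1 / Real.sqrt 2 : ℝ) : ℂ) * ((1 / Real.sqrt 2 : ℝ) : ℂ) = 1 / 2 := by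
    rw [← Complex.ofReal_mul, div_mul_div_comm, Real.mul_self_sqrt (by norm_num)]
    norm_num
  simp only [noisyGHZ, ghzVector, Matrix.add_apply, Matrix.smul_apply, Matrix.vecMulVec_apply,
    Pi.smul_apply, Pi.add_apply, Pi.star_apply, Pi.single_apply, smul_eq_mul, Matrix.one_apply,
    star_mul', star_add, Complex.star_def, Complex.conj_ofReal]
  have hc : ∀ q : Prop, ∀ [Decidable q],
      (starRingEnd ℂ) (if q then 1 else 0) = if q then 1 else 0 := by
    intro q _; split_ifs <;> simp
  rw [hc, hc]
  push_cast at h ⊢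
  linear_combination (p : ℂ) *
      ((if x = fun _ => 0 then 1 else 0) + (if x = fun _ => 1 then 1 else 0)) *
      ((if y = fun _ => 0 then 1 else 0) + (if y = fun _ => 1 then 1 else 0)) * h

theorem phaseAverage_apply_self {N : ℕ} (π : QubitPartition N) (x : QubitString (Fin N)) :
    phaseAverage π x x = if π.IsUnion (onesSet x) then 1 else 0 := by
  simp [phaseAverage, stringDiff]

/-- Away from the diagonal the phase average consists of the two corner coherences only. -/
theorem phaseAverage_apply_of_ne {N : ℕ} (hN : 0 < N) (π : QubitPartition N)
    {x y : QubitString (Fin N)} (hxy : x ≠ y) :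
    phaseAverage π x y =
      ((if x = fun _ => 0 then 1 else 0) + (if x = fun _ => 1 then 1 else 0)) *
      ((if y = fun _ => 0 then 1 else 0) + (if y = fun _ => 1 then 1 else 0)) := by
  have h01 : (fun _ : Fin N => (0 : Fin 2)) ≠ fun _ => 1 := fun h => by
    simpa using congrFun h ⟨0, hN⟩
  have hU : ∀ c : Fin 2, π.IsUnion (onesSet fun _ => c) := fun c =>
    QubitPartition.isUnion_onesSet_iff.2 fun _ _ => ⟨c, fun _ => rfl⟩
  have hconst : (∀ k l, stringDiff x y k = stringDiff x y l) ↔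
      (x = (fun _ => 0) ∧ y = fun _ => 1) ∨ (x = (fun _ => 1) ∧ y = fun _ => 0) := by
    constructor
    · intro h
      obtain ⟨k, hk⟩ := Function.ne_iff.1 hxy
      simp only [stringDiff] at h
      rcases lt_or_gt_of_ne hk with hlt | hlt
      · left
        constructor <;> funext i <;> have := h i k <;> omega
      · right
        constructor <;> funext i <;> have := h i k <;> omega
    · rintro (⟨rfl, rfl⟩ | ⟨rfl, rfl⟩) <;> simp [stringDiff]
  rw [phaseAverage, Matrix.of_apply]
  simp only [hconst]
  by_cases hx0 : x = fun _ => 0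
  · subst hx0
    by_cases hy : y = fun _ => 1
    · subst hy; simp [hU, h01, h01.symm]
    · simp [hy, h01, hxy.symm]
  · by_cases hx1 : x = fun _ => 1
    · subst hx1
      by_cases hy : y = fun _ => 0
      · subst hy; simp [hU, h01, h01.symm]
      · simp [hy, h01.symm, hxy.symm]
    · simp [hx0, hx1]

theorem diagonal_mem_span_isProductState {N : ℕ} (π : QubitPartition N)
    {D : QubitString (Fin N) → ℝ} (hD : ∀ x, 0 ≤ D x) :
    Matrix.diagonal (fun x => (D x : ℂ)) ∈ Submodule.span ℝ≥0 {τ | IsProductState π τ} := by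
  have h : Matrix.diagonal (fun x => (D x : ℂ)) =
      ∑ x, D x • (Matrix.single x x 1 : Matrix (QubitString (Fin N)) (QubitString (Fin N)) ℂ) := by
    ext y z
    simp only [Matrix.sum_apply, Matrix.smul_apply, Matrix.single_apply, Matrix.diagonal_apply]
    by_cases hyz : y = z
    · subst hyz; simp
    · rw [if_neg hyz]
      refine (Finset.sum_eq_zero fun x _ => ?_).symm
      rw [if_neg (by rintro ⟨rfl, h⟩; exact hyz h), smul_zero]
  rw [h]
  exact Submodule.sum_mem _ fun x _ =>
    real_smul_mem_span (hD x) (Submodule.subset_span (isProductState_single π x))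

theorem noisyGHZ_apply_self {N : ℕ} (hN : 0 < N) (p : ℝ) (x : QubitString (Fin N)) :
    noisyGHZ N p x x = ((p / 2 *
      ((if x = fun _ => 0 then 1 else 0) + (if x = fun _ => 1 then 1 else 0)) +
      (1 - p) / 2 ^ N : ℝ) : ℂ) := by
  have h01 : (fun _ : Fin N => (0 : Fin 2)) ≠ fun _ => 1 := fun h => by
    simpa using congrFun h ⟨0, hN⟩
  rw [noisyGHZ_apply]
  by_cases hx : x = fun _ => 0
  · subst hx; simp [h01]
  · by_cases hx' : x = fun _ => 1 <;> simp [hx, hx', h01.symm]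

theorem trace_noisyGHZ {N : ℕ} (hN : 0 < N) (p : ℝ) : (noisyGHZ N p).trace = 1 := by
  simp only [Matrix.trace, Matrix.diag_apply, noisyGHZ_apply_self hN, ← Complex.ofReal_sum,
    Finset.sum_add_distrib, ← Finset.mul_sum]
  simp
  field_simp
  ring

/-- The bound on `p` in the form in which both directions use it: the corner coherence `p / 2`
times `(N - 2 * j) / N` against the population `(1 - p) / 2 ^ N`. -/
theorem le_threshold_iff {N j : ℕ} (hN : 0 < N) (hj : 2 * j + 1 ≤ N) (p : ℝ) :
    p ≤ 1 / (1 + ((N : ℝ) - 2 * (j : ℝ)) / (N : ℝ) * 2 ^ (N - 1)) ↔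
      ((N : ℝ) - 2 * j) * (p / 2) ≤ N * ((1 - p) / 2 ^ N) := by
  obtain ⟨n, rfl⟩ : ∃ n, N = n + 1 := ⟨N - 1, by omega⟩
  have hj' : (0 : ℝ) ≤ ((n + 1 : ℕ) : ℝ) - 2 * j := by
    have : ((2 * j + 1 : ℕ) : ℝ) ≤ (n + 1 : ℕ) := by exact_mod_cast hj
    push_cast at this ⊢
    linarith
  have hN' : (0 : ℝ) < ((n + 1 : ℕ) : ℝ) := by positivity
  set M : ℝ := ((n + 1 : ℕ) : ℝ)
  set s : ℝ := M - 2 * j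
  have h2 : (0 : ℝ) < 2 ^ n := by positivity
  rw [le_div_iff₀ (by positivity), Nat.add_sub_cancel, pow_succ]
  have e1 : p * (1 + s / M * 2 ^ n) = p + p * s * 2 ^ n / M := by field_simp
  have e2 : M * ((1 - p) / (2 ^ n * 2)) = M * (1 - p) / 2 ^ n / 2 := by field_simp
  have e3 : s * (p / 2) = (s * p) / 2 := by ring
  rw [e1, e2, e3, div_le_div_iff_of_pos_right two_pos, le_div_iff₀ h2, ← le_sub_iff_add_le',
    div_le_iff₀ hN']
  rw [mul_comm M, mul_comm s p]

theorem isSeparableForType_noisyGHZ {N j : ℕ} (hj : 2 * j + 1 ≤ N) {p : ℝ} (hp0 : 0 ≤ p)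
    (hp1 : p ≤ 1) (hp : ((N : ℝ) - 2 * j) * (p / 2) ≤ N * ((1 - p) / 2 ^ N)) :
    IsSeparableForType (singlesAndPairs N j) (noisyGHZ N p) := by
  have hN : 0 < N := by omega
  obtain ⟨π, hπ⟩ := exists_qubitPartition_singlesAndPairs (N := N) (j := j) (by omega)
  let S : Set (Matrix (QubitString (Fin N)) (QubitString (Fin N)) ℂ) :=
    {τ | ∃ π : QubitPartition N, π.sizes = singlesAndPairs N j ∧ IsProductState π τ}
  have hSub : ∀ π : QubitPartition N, π.sizes = singlesAndPairs N j →
      Submodule.span ℝ≥0 {τ | IsProductState π τ} ≤ Submodule.span ℝ≥0 S := fun π hπ =>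
    Submodule.span_mono fun τ hτ => ⟨π, hπ, hτ⟩
  have hS : noisyGHZ N p ∈ convexHull ℝ S → IsSeparableForType (singlesAndPairs N j)
      (noisyGHZ N p) := fun h => by
    refine convexHull_mono ?_ h
    rintro τ ⟨π, hπ, hτ⟩
    exact ⟨π, hπ, subset_convexHull ℝ _ hτ⟩
  refine hS (mem_convexHull_of_mem_span_of_trace (by rintro τ ⟨π, _, hτ⟩; exact hτ.trace_eq_one) ?_
    (trace_noisyGHZ hN p))
  -- `F x` is the `(x, x)` entry of the mean of the phase averages of all relabellings of `π`
  let F : QubitString (Fin N) → ℝ := fun x =>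
    (Finset.univ.filter fun g : Equiv.Perm (Fin N) => (π.perm g).IsUnion (onesSet x)).card /
      N.factorial
  let D : QubitString (Fin N) → ℝ := fun x => (noisyGHZ N p x x).re - p / 2 * F x
  have hfac : (0 : ℝ) < N.factorial := by exact_mod_cast N.factorial_pos
  have hnoise : 0 ≤ (1 - p) / 2 ^ N := div_nonneg (by linarith) (by positivity)
  have hF1 : ∀ x, F x ≤ 1 := by
    intro x
    rw [div_le_one hfac]
    have := Finset.card_le_univ
      (Finset.univ.filter fun g : Equiv.Perm (Fin N) => (π.perm g).IsUnion (onesSet x))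
    rw [Fintype.card_perm, Fintype.card_fin] at this
    exact_mod_cast this
  have hD : ∀ x, 0 ≤ D x := by
    intro x
    have hFx := mul_le_mul_of_nonneg_left (hF1 x) (show 0 ≤ p / 2 by linarith)
    simp only [D, noisyGHZ_apply_self hN, Complex.ofReal_re]
    by_cases hx : x = fun _ => 0
    · rw [if_pos hx]
      split_ifs <;> linarith
    by_cases hx' : x = fun _ => 1
    · rw [if_neg hx, if_pos hx']
      linarith
    have hA : 0 < (onesSet x).card := by
      rw [Finset.card_pos]
      obtain ⟨i, hi⟩ := Function.ne_iff.1 hx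
      exact ⟨i, by simp [onesSet]; omega⟩
    have hAN : (onesSet x).card < N := by
      obtain ⟨i, hi⟩ := Function.ne_iff.1 hx'
      have := Finset.card_lt_univ_of_notMem (s := onesSet x) (x := i) (by simpa [onesSet] using hi)
      simpa using this
    have hcount := QubitPartition.mul_card_perm_isUnion_le hj hπ hA hAN
    have hcount' : (N : ℝ) * F x ≤ (N : ℝ) - 2 * j := by
      have h : ((N - 2 * j : ℕ) : ℝ) = (N : ℝ) - 2 * j := by
        rw [Nat.cast_sub (by omega)]; push_cast; ring
      rw [← h, ← mul_div_assoc, div_le_iff₀ hfac]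
      exact_mod_cast hcount
    have hN' : (0 : ℝ) < N := by exact_mod_cast hN
    rw [if_neg hx, if_neg hx', add_zero, mul_zero, zero_add, sub_nonneg]
    refine le_of_mul_le_mul_left ?_ hN'
    calc (N : ℝ) * (p / 2 * F x) = N * F x * (p / 2) := by ring
      _ ≤ ((N : ℝ) - 2 * j) * (p / 2) :=
          mul_le_mul_of_nonneg_right hcount' (by linarith)
      _ ≤ _ := hp
  have hdec : noisyGHZ N p = ∑ g : Equiv.Perm (Fin N),
      (p / 2 / N.factorial) • phaseAverage (π.perm g) + Matrix.diagonal fun x => (D x : ℂ) := by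
    ext x y
    rw [Matrix.add_apply, Matrix.sum_apply]
    simp only [Matrix.smul_apply]
    by_cases hxy : x = y
    · subst hxy
      rw [Matrix.diagonal_apply_eq]
      simp only [phaseAverage_apply_self, Complex.real_smul, ← Finset.mul_sum,
        Finset.sum_boole, D, noisyGHZ_apply_self hN, Complex.ofReal_re, F]
      push_cast
      ring
    · simp only [phaseAverage_apply_of_ne hN _ hxy]
      rw [Matrix.diagonal_apply_ne _ hxy, noisyGHZ_apply, if_neg hxy, Finset.sum_const,
        Finset.card_univ, Fintype.card_perm, Fintype.card_fin, ← Nat.cast_smul_eq_nsmul ℝ,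
        smul_smul, mul_div_cancel₀ _ hfac.ne', Complex.real_smul]
      ring
  rw [hdec]
  refine Submodule.add_mem _ (Submodule.sum_mem _ fun g _ => ?_) ?_
  · exact hSub (π.perm g) ((π.sizes_perm g).trans hπ)
      (real_smul_mem_span (by positivity) (phaseAverage_mem_span _))
  · exact hSub π hπ (diagonal_mem_span_isProductState π hD)

theorem IsSeparableForType.isKSeparable {N j : ℕ} (hj : 2 * j ≤ N)
    {ρ : Matrix (QubitString (Fin N)) (QubitString (Fin N)) ℂ}
    (h : IsSeparableForType (singlesAndPairs N j) ρ) : IsKSeparable (N - j) ρ := by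
  refine convexHull_mono ?_ h
  rintro τ ⟨π, hπ, hτ⟩
  refine ⟨π, ?_, hτ⟩
  rw [π.card_parts_eq, hπ]
  simp [singlesAndPairs]
  omega

theorem bitString_eq_zero_iff {N : ℕ} {A : Finset (Fin N)} :
    (bitString A = fun _ => 0) ↔ A = ∅ := by
  simp [bitString, funext_iff, Finset.eq_empty_iff_forall_notMem]

theorem bitString_eq_one_iff {N : ℕ} {A : Finset (Fin N)} :
    (bitString A = fun _ => 1) ↔ A = Finset.univ := by
  simp [bitString, funext_iff, Finset.eq_univ_iff_forall]

theorem le_of_isKSeparable_noisyGHZ {N j : ℕ} (hN : 2 ≤ N) (hj : 2 * j + 1 ≤ N) {p : ℝ}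
    (h : IsKSeparable (N - j) (noisyGHZ N p)) :
    ((N : ℝ) - 2 * j) * (p / 2) ≤ N * ((1 - p) / 2 ^ N) := by
  have h1 := h.mul_corner_le hj
  have : Nontrivial (Fin N) := Fin.nontrivial_iff_two_le.2 hN
  have hne : (∅ : Finset (Fin N)) ≠ Finset.univ := Finset.univ_nonempty.ne_empty.symm
  have hcorner : (noisyGHZ N p (bitString ∅) (bitString Finset.univ)).re = p / 2 := by
    have h2 : bitString (∅ : Finset (Fin N)) ≠ bitString Finset.univ := by
      rw [bitString_eq_zero_iff.2 rfl]
      exact fun h => hne (bitString_eq_zero_iff.1 h.symm).symm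
    rw [noisyGHZ_apply, if_neg h2]
    simp [bitString_eq_zero_iff, bitString_eq_one_iff, hne, hne.symm]
  have hpop : ∀ A : Finset (Fin N), A ≠ ∅ → A ≠ Finset.univ →
      (noisyGHZ N p (bitString A) (bitString A)).re = (1 - p) / 2 ^ N := by
    intro A h0 h1
    rw [noisyGHZ_apply_self (by omega), Complex.ofReal_re, if_neg (bitString_eq_zero_iff.not.2 h0),
      if_neg (bitString_eq_one_iff.not.2 h1)]
    ring
  have hs : ∀ i : Fin N, ({i} : Finset (Fin N)) ≠ Finset.univ := fun i h => by
    obtain ⟨k, hk⟩ := exists_ne i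
    exact hk (Finset.mem_singleton.1 (h ▸ Finset.mem_univ k))
  rw [hcorner, singleFlipPopulation, Finset.sum_congr rfl fun i _ => by
    rw [hpop {i} (Finset.singleton_ne_empty i) (hs i),
      hpop {i}ᶜ (Finset.compl_eq_empty_iff _ |>.not.2 (hs i))
        (Finset.compl_eq_univ_iff _ |>.not.2 (Finset.singleton_ne_empty i)),
      add_self_div_two]] at h1
  simpa using h1

theorem mainTheorem1 (N j : ℕ) (hN : 2 ≤ N) (hj : 2 * j + 1 ≤ N)
    (p : ℝ) (hp0 : 0 ≤ p) (hp1 : p ≤ 1) :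
    (IsKSeparable (N - j) (noisyGHZ N p) ↔
      p ≤ 1 / (1 + ((N : ℝ) - 2 * (j : ℝ)) / (N : ℝ) * 2 ^ (N - 1))) ∧
    (IsSeparableForType (singlesAndPairs N j) (noisyGHZ N p) ↔
      p ≤ 1 / (1 + ((N : ℝ) - 2 * (j : ℝ)) / (N : ℝ) * 2 ^ (N - 1))) := by
  rw [le_threshold_iff (by omega) hj]
  have hK := fun h => le_of_isKSeparable_noisyGHZ (p := p) hN hj h
  have hT := isSeparableForType_noisyGHZ hj hp0 hp1
  exact ⟨⟨hK, fun h => (hT h).isKSeparable (by omega)⟩,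
    ⟨fun h => hK (h.isKSeparable (by omega)), hT⟩⟩
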